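/- All graphs are finite, simple and undirected. For a graph $G$ with adjacency matrix $A(G)$ and diagonal degree matrix $D(G)$, and for $\alpha\in[0,1]$, let $A_\alpha(G)=\alpha D(G)+(1-\alpha)A(G)$, and let $\rho_\alpha(G)$ denote the largest eigenvalue of $A_\alpha(G)$. A graph is $3$-connected if it has more than three vertices and removing fewer than three vertices always leaves a connected graph; it is minimally $3$-connected if it is $3$-connected and deleting any edge leaves a graph which is not $3$-connected. Let $W_n=K_1\vee C_{n-1}$ be the wheel on $n$ vertices, obtained from the cycle $C_{n-1}$ by adding one new vertex adjacent to all vertices of the cycle. Theorem 1.2. Let $G$ be a minimally $3$-connected graph of order $n\ge 7$, and let $\alpha\in[\tfrac12,1)$. Then $$\rho_\alpha(G)\le\rho_\alpha(W_n),$$ with equality if and only if $G\cong W_n$. -/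

import Mathlib

namespace SimpleGraph

/-- `G` is `k`-connected: it has more than `k` vertices, and removing fewer than `k` vertices
always leaves a connected graph. -/
def IsKConnected {V : Type*} [Fintype V] (G : SimpleGraph V) (k : ℕ) : Prop :=
  k < Fintype.card V ∧ ∀ S : Finset V, S.card < k → (G.induce ((S : Set V)ᶜ)).Connected

/-- `G` is minimally `k`-connected: it is `k`-connected, and deleting any edge leaves a graph
which is not `k`-connected. -/
def IsMinimallyKConnected {V : Type*} [Fintype V] (G : SimpleGraph V) (k : ℕ) : Prop :=
  G.IsKConnected k ∧ ∀ e ∈ G.edgeSet, ¬ (G.deleteEdges {e}).IsKConnected k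

/-- The join `G ∨ H`: the disjoint union of `G` and `H`, together with all edges between them. -/
def joinGraph {V W : Type*} (G : SimpleGraph V) (H : SimpleGraph W) : SimpleGraph (V ⊕ W) :=
  (G ⊕g H) ⊔ completeBipartiteGraph V W

/-- The wheel `W_n = K_1 ∨ C_{n-1}` on `n` vertices (meant for `n ≥ 4`). -/
def wheelGraph (n : ℕ) : SimpleGraph (Fin 1 ⊕ Fin (n - 1)) :=
  (completeGraph (Fin 1)).joinGraph (cycleGraph (n - 1))

open Classical in
/-- The matrix `A_α(G) = α D(G) + (1 - α) A(G)`. -/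
noncomputable def alphaMatrix {V : Type*} [Fintype V] (G : SimpleGraph V) (α : ℝ) :
    Matrix V V ℝ :=
  α • G.degMatrix ℝ + (1 - α) • G.adjMatrix ℝ

/-- The `α`-index `ρ_α(G)`: the largest eigenvalue of `A_α(G)`. -/
noncomputable def alphaIndex {V : Type*} [Fintype V] (G : SimpleGraph V) (α : ℝ) : ℝ :=
  sSup {μ : ℝ | Module.End.HasEigenvalue (G.alphaMatrix α).mulVecLin μ}

/-- The supremum in the definition of the `α`-index is attained: it is the largest eigenvalue. -/
theorem isGreatest_alphaIndex {V : Type*} [Fintype V] [Nonempty V] (G : SimpleGraph V) (α : ℝ) :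
    IsGreatest {μ : ℝ | Module.End.HasEigenvalue (G.alphaMatrix α).mulVecLin μ}
      (G.alphaIndex α) := by
  classical
  have hfin : {μ : ℝ | Module.End.HasEigenvalue (G.alphaMatrix α).mulVecLin μ}.Finite :=
    Module.End.finite_hasEigenvalue _
  have hH : (G.alphaMatrix α).IsHermitian := by
    unfold alphaMatrix
    ext i j
    by_cases h : i = j
    · subst h; simp
    · simp [degMatrix, h, Ne.symm h, adj_comm]
  have hne : {μ : ℝ | Module.End.HasEigenvalue (G.alphaMatrix α).mulVecLin μ}.Nonempty := by
    obtain ⟨i⟩ := ‹Nonempty V›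
    refine ⟨hH.eigenvalues i, Module.End.hasEigenvalue_of_hasEigenvector
      (x := (hH.eigenvectorBasis i).ofLp) ⟨?_, ?_⟩⟩
    · rw [Module.End.mem_eigenspace_iff]
      simpa using hH.mulVec_eigenvectorBasis i
    · intro h
      exact hH.eigenvectorBasis.orthonormal.ne_zero i (by ext j; simpa using congrFun h j)
  exact ⟨hne.csSup_mem hfin, fun μ hμ => le_csSup hfin.bddAbove hμ⟩

end SimpleGraph

/-!
Every edge `uv` of a minimally `3`-connected graph `G` comes with a separation: deleting `uv` and
two vertices `S` leaves a part `U ∋ u` and a part that contains `v`, joined in `G` by the edge `uv`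
alone (`IsEdgeSeparation`). In particular `U \ {u}` consists of non-neighbours of `v`, and when
`d(u) ≥ 4` it contains a neighbour of `u`. This controls the degrees of the neighbours of a vertex
`v` of large degree.

* If `v` is adjacent to all other vertices, those have degree three. Then `G - v` is connected and
  `2`-regular, hence a cycle, and `G` is the wheel (`nonempty_iso_wheelGraph`).
* No vertex `v` has exactly one non-neighbour `w`: the neighbours of `v` would all have degree
  three, and the connected graph `G - v - w` would have too few edges (`false_of_unique_not_adj`).
* If no vertex is adjacent to all others, then all degrees are at most `n - 3`, and the degrees of
  the neighbours of `v` add up to at most `d(v) (n - d(v))`, with an excess of at most two when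
  `d(v) = n - 3` (`sum_degree_neighborFinset_le`). The extremal case without excess includes the
  hubs of `K_{3,n-3}`.

On the spectral side, if `y` is a positive vector with `A_α(G) y < r y`, then `ρ_α(G) < r`
(`alphaIndex_lt_of_mulVec_lt`). With the degree vector for `y`, this requires
`α d(v)² + (1 - α) ∑_{u ~ v} d(u) < r d(v)` at each vertex. When no vertex is adjacent to all
others, the degree sums above and `α ≥ 1 / 2` give this for every `r` above
`α (n - 2) + 2 (1 - α) (n - 2) / (n - 3)`. That number is less than `ρ_α(W_n)`, which is at least
the larger root of the characteristic quadratic of the hub-rim quotient of the wheel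
(`lt_alphaIndex_wheelGraph`). So such a graph has strictly smaller `α`-index than the wheel.
-/

namespace SimpleGraph

/-! ### Bounds for the `α`-index and its value on wheels -/

open Classical in
theorem alphaMatrix_mulVec_apply {V : Type*} [Fintype V] (G : SimpleGraph V) (α : ℝ)
    (y : V → ℝ) (v : V) :
    (G.alphaMatrix α).mulVec y v
      = α * (G.degree v * y v) + (1 - α) * ∑ u ∈ G.neighborFinset v, y u := by
  rw [alphaMatrix, Matrix.add_mulVec, Matrix.smul_mulVec, Matrix.smul_mulVec, Pi.add_apply,
    Pi.smul_apply, Pi.smul_apply, degMatrix, Matrix.mulVec_diagonal, adjMatrix_mulVec_apply,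
    smul_eq_mul, smul_eq_mul]

/-- Collatz–Wielandt upper bound: the matrix `A_α` is nonnegative, so a positive vector that it
maps strictly below its `r`-multiple forces `ρ_α < r`. -/
theorem alphaIndex_lt_of_mulVec_lt {V : Type*} [Fintype V] [Nonempty V] (G : SimpleGraph V)
    {α r : ℝ} (h0 : 0 ≤ α) (h1 : α ≤ 1) (y : V → ℝ) (hy : ∀ v, 0 < y v)
    (h : ∀ v, (G.alphaMatrix α).mulVec y v < r * y v) : G.alphaIndex α < r := by
  classical
  obtain ⟨x, hx⟩ := (G.isGreatest_alphaIndex α).1.exists_hasEigenvector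
  set μ := G.alphaIndex α
  have hmul : ∀ v, (G.alphaMatrix α).mulVec x v = μ * x v := fun v => by
    have := congrFun hx.apply_eq_smul v
    simpa using this
  -- the ratio `|x v| / y v` is largest at `v`
  obtain ⟨v, -, hv⟩ := Finset.exists_max_image Finset.univ (fun v => |x v| / y v)
    Finset.univ_nonempty
  have hle : ∀ u, |x u| ≤ |x v| / y v * y u := fun u =>
    (div_le_iff₀ (hy u)).1 (hv u (Finset.mem_univ u))
  have hxv : 0 < |x v| := by
    by_contra hcon
    have h00 : |x v| = 0 := le_antisymm (not_lt.1 hcon) (abs_nonneg _)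
    apply hx.2
    ext u
    have := hle u
    rw [h00] at this
    simpa using this
  have key : μ * |x v| ≤ |x v| / y v * (G.alphaMatrix α).mulVec y v := by
    calc μ * |x v| ≤ |μ * x v| := by
          rw [abs_mul]; exact mul_le_mul_of_nonneg_right (le_abs_self _) (abs_nonneg _)
      _ = |α * (G.degree v * x v) + (1 - α) * ∑ u ∈ G.neighborFinset v, x u| := by
          rw [← hmul, alphaMatrix_mulVec_apply]
      _ ≤ α * (G.degree v * |x v|) + (1 - α) * ∑ u ∈ G.neighborFinset v, |x u| := by
          refine (abs_add_le _ _).trans (add_le_add ?_ ?_)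
          · rw [abs_mul, abs_mul, abs_of_nonneg h0, Nat.abs_cast]
          · rw [abs_mul, abs_of_nonneg (by linarith : (0:ℝ) ≤ 1 - α)]
            exact mul_le_mul_of_nonneg_left (Finset.abs_sum_le_sum_abs _ _) (by linarith)
      _ ≤ α * (G.degree v * (|x v| / y v * y v))
            + (1 - α) * ∑ u ∈ G.neighborFinset v, |x v| / y v * y u := by
          have := hle v
          have h1' : (0:ℝ) ≤ 1 - α := by linarith
          gcongr
          exact hle _
      _ = _ := by
          rw [alphaMatrix_mulVec_apply, ← Finset.mul_sum]; ring
  have h2 : |x v| / y v * (G.alphaMatrix α).mulVec y v < |x v| / y v * (r * y v) :=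
    mul_lt_mul_of_pos_left (h v) (div_pos hxv (hy v))
  have h3 : |x v| / y v * (r * y v) = r * |x v| := by
    have := (hy v).ne'
    field_simp
  rw [h3] at h2
  exact lt_of_mul_lt_mul_right (key.trans_lt h2) hxv.le

theorem le_alphaIndex_of_mulVec_eq {V : Type*} [Fintype V] [Nonempty V] (G : SimpleGraph V)
    {α r : ℝ} (y : V → ℝ) (hy : y ≠ 0) (h : ∀ v, (G.alphaMatrix α).mulVec y v = r * y v) :
    r ≤ G.alphaIndex α := by
  refine (G.isGreatest_alphaIndex α).2 (Module.End.hasEigenvalue_of_hasEigenvector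
    (x := y) ⟨?_, hy⟩)
  rw [Module.End.mem_eigenspace_iff]
  ext v
  simpa using h v

theorem alphaIndex_le_of_iso {V W : Type*} [Fintype V] [Fintype W] [Nonempty V] [Nonempty W]
    {G : SimpleGraph V} {H : SimpleGraph W} (e : G ≃g H) (α : ℝ) :
    G.alphaIndex α ≤ H.alphaIndex α := by
  classical
  obtain ⟨x, hx⟩ := (G.isGreatest_alphaIndex α).1.exists_hasEigenvector
  refine H.le_alphaIndex_of_mulVec_eq (x ∘ e.symm) (fun h => hx.2 ?_) fun w => ?_
  · ext v
    simpa using congrFun h (e v)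
  · have hv := congrFun hx.apply_eq_smul (e.symm w)
    rw [Matrix.mulVecLin_apply, alphaMatrix_mulVec_apply] at hv
    rw [alphaMatrix_mulVec_apply, Function.comp_apply, ← e.symm.degree_eq w]
    have : ∑ u ∈ H.neighborFinset w, (x ∘ e.symm) u
        = ∑ u ∈ G.neighborFinset (e.symm w), x u := by
      refine Finset.sum_equiv e.symm.toEquiv (fun u => ?_) (fun u _ => rfl)
      simpa using (e.symm.map_adj_iff (v := w) (w := u)).symm
    rw [this]
    simpa using hv

theorem alphaIndex_eq_of_iso {V W : Type*} [Fintype V] [Fintype W] [Nonempty V] [Nonempty W]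
    {G : SimpleGraph V} {H : SimpleGraph W} (e : G ≃g H) (α : ℝ) :
    G.alphaIndex α = H.alphaIndex α :=
  le_antisymm (alphaIndex_le_of_iso e α) (alphaIndex_le_of_iso e.symm α)

theorem wheelGraph_adj_inl_inl {n : ℕ} (i j : Fin 1) :
    ¬ (wheelGraph n).Adj (Sum.inl i) (Sum.inl j) := by
  simp [wheelGraph, joinGraph, completeBipartiteGraph, Subsingleton.elim i j]

theorem wheelGraph_adj_inl_inr {n : ℕ} (i : Fin 1) (j : Fin (n - 1)) :
    (wheelGraph n).Adj (Sum.inl i) (Sum.inr j) := by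
  simp [wheelGraph, joinGraph, completeBipartiteGraph]

theorem wheelGraph_adj_inr_inr {n : ℕ} (i j : Fin (n - 1)) :
    (wheelGraph n).Adj (Sum.inr i) (Sum.inr j) ↔ (cycleGraph (n - 1)).Adj i j := by
  simp [wheelGraph, joinGraph, completeBipartiteGraph]

/-- The vector equal to `c` at the hub of the wheel and to `1` on its rim is an eigenvector of
`A_α` as soon as it solves the eigenvalue equation at the hub and at one rim vertex. -/
theorem le_alphaIndex_wheelGraph {n : ℕ} (hn : 4 ≤ n) {α r c : ℝ}
    (hhub : α * ((n - 1) * c) + (1 - α) * (n - 1) = r * c)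
    (hrim : 3 * α + (1 - α) * (c + 2) = r) : r ≤ (wheelGraph n).alphaIndex α := by
  classical
  obtain ⟨m, rfl⟩ : ∃ m, n = m + 4 := ⟨n - 4, by omega⟩
  have hne : Nonempty (Fin 1 ⊕ Fin (m + 4 - 1)) := ⟨Sum.inl 0⟩
  set y : Fin 1 ⊕ Fin (m + 4 - 1) → ℝ := Sum.elim (fun _ => c) (fun _ => 1) with hydef
  have hhubN : ∀ i, (wheelGraph (m + 4)).neighborFinset (Sum.inl i)
      = Finset.univ.map ⟨Sum.inr, Sum.inr_injective⟩ := by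
    intro i
    ext u
    rw [mem_neighborFinset]
    rcases u with u | u
    · simpa using wheelGraph_adj_inl_inl i u
    · simpa using wheelGraph_adj_inl_inr i u
  have hrimN : ∀ i, (wheelGraph (m + 4)).neighborFinset (Sum.inr i)
      = insert (Sum.inl 0)
        (((cycleGraph (m + 3)).neighborFinset i).map ⟨Sum.inr, Sum.inr_injective⟩) := by
    intro i
    ext u
    rw [mem_neighborFinset]
    rcases u with u | u
    · simpa [Subsingleton.elim u 0] using (wheelGraph_adj_inl_inr 0 i).symm
    · simpa using wheelGraph_adj_inr_inr i u
  have hni : ∀ i, (Sum.inl 0 : Fin 1 ⊕ Fin (m + 4 - 1)) ∉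
      (((cycleGraph (m + 3)).neighborFinset i).map ⟨Sum.inr, Sum.inr_injective⟩) := by
    simp
  have hcard : ∀ i, ((cycleGraph (m + 3)).neighborFinset i).card = 2 := fun i =>
    by rw [card_neighborFinset_eq_degree]; convert cycleGraph_degree_three_le (v := i)
  refine le_alphaIndex_of_mulVec_eq _ y (fun h => ?_) (fun v => ?_)
  · simpa [hydef] using congrFun h (Sum.inr ⟨0, by omega⟩)
  · rw [alphaMatrix_mulVec_apply, ← card_neighborFinset_eq_degree]
    rcases v with i | i
    · rw [hhubN]
      push_cast at hhub
      simp [hydef]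
      rw [← hhub]; ring
    · rw [hrimN, Finset.card_insert_of_notMem (hni i), Finset.sum_insert (hni i),
        Finset.card_map, Finset.sum_map, hcard]
      simp only [hydef, Sum.elim_inl, Sum.elim_inr, Function.Embedding.coeFn_mk, Finset.sum_const]
      rw [hcard]
      norm_num
      linarith

/-! ### Separations of the edges of a minimally `3`-connected graph -/

section MinimallyThreeConnected

open Classical

variable {V : Type*} {G : SimpleGraph V}

/-- The pair `S` separates `u` from `v` once the edge `uv` is deleted: `U` is the part that
contains `u`, the part that contains `v` is the complement of `U ∪ S`, and `uv` is the only edge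
between the two parts. -/
structure IsEdgeSeparation (G : SimpleGraph V) (u v : V) (U S : Finset V) : Prop where
  mem : u ∈ U
  card_eq : S.card = 2
  notMem_of_mem : ∀ x ∈ U, x ∉ S
  right_notMem : v ∉ U
  right_notMem' : v ∉ S
  closed : ∀ x ∈ U, ∀ y, G.Adj x y → y ∈ U ∨ y ∈ S ∨ (x = u ∧ y = v)

namespace IsEdgeSeparation

variable {u v : V} {U S : Finset V}

theorem not_adj_right (h : G.IsEdgeSeparation u v U S) {x : V} (hx : x ∈ U) (hxu : x ≠ u) :
    ¬ G.Adj x v := fun hadj => by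
  rcases h.closed x hx v hadj with h1 | h1 | h1
  exacts [h.right_notMem h1, h.right_notMem' h1, hxu h1.1]

theorem not_adj (h : G.IsEdgeSeparation u v U S) {x y : V} (hx : x ∈ U) (hyU : y ∉ U)
    (hyS : y ∉ S) (hyv : y ≠ v) : ¬ G.Adj x y := fun hadj => by
  rcases h.closed x hx y hadj with h1 | h1 | h1
  exacts [hyU h1, hyS h1, hyv h1.2]

theorem ne_right (h : G.IsEdgeSeparation u v U S) {x : V} (hx : x ∈ U) : x ≠ v := by
  rintro rfl; exact h.right_notMem hx

theorem card_union (h : G.IsEdgeSeparation u v U S) :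
    (U.erase u ∪ insert v S).card = U.card + 2 := by
  rw [Finset.card_union_of_disjoint, Finset.card_erase_of_mem h.mem,
    Finset.card_insert_of_notMem h.right_notMem', h.card_eq]
  · have := Finset.card_pos.2 ⟨u, h.mem⟩
    omega
  · rw [Finset.disjoint_left]
    intro x hx hx'
    have hxU := Finset.mem_of_mem_erase hx
    rcases Finset.mem_insert.1 hx' with rfl | h1
    exacts [h.right_notMem hxU, h.notMem_of_mem x hxU h1]

end IsEdgeSeparation

variable [Fintype V]

/-- In a `k`-connected graph, a set `U` whose neighbours outside `U` lie in a set `S` of fewer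
than `k` vertices leaves no vertex outside `U ∪ S`. -/
theorem IsKConnected.mem_or_mem {k : ℕ} (h : G.IsKConnected k) {U S : Finset V}
    (hS : S.card < k) {u : V} (hu : u ∈ U) (huS : u ∉ S)
    (hN : ∀ x ∈ U, ∀ y, G.Adj x y → y ∈ U ∨ y ∈ S) (z : V) : z ∈ U ∨ z ∈ S := by
  by_cases hz : z ∈ S
  · exact Or.inr hz
  refine Or.inl ?_
  have hconn := (h.2 S hS).preconnected ⟨u, by simpa using huS⟩ ⟨z, by simpa using hz⟩
  obtain ⟨p⟩ := hconn
  have key : ∀ {a b : ((S : Set V)ᶜ : Set V)}, (G.induce ((S : Set V)ᶜ)).Walk a b →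
      (a : V) ∈ U → (b : V) ∈ U := by
    intro a b p
    induction p with
    | nil => exact id
    | @cons a c b hac p ih =>
      intro ha
      refine ih ((hN a ha c hac).resolve_right fun hc => c.2 ?_)
      simpa using hc
  exact key p hu

theorem IsKConnected.three_le_degree (h : G.IsKConnected 3) (v : V) : 3 ≤ G.degree v := by
  by_contra! hlt
  have hall := h.mem_or_mem (U := {v}) (S := G.neighborFinset v) (u := v) hlt (by simp)
    (by simp) (by intro x hx y hxy; rw [Finset.mem_singleton] at hx; subst hx; right; simpa)
  have : (Finset.univ : Finset V) ⊆ {v} ∪ G.neighborFinset v := fun z _ => by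
    rw [Finset.mem_union]; exact hall z
  have h1 := (Finset.card_le_card this).trans (Finset.card_union_le _ _)
  rw [Finset.card_univ, Finset.card_singleton, card_neighborFinset_eq_degree] at h1
  have := h.1
  omega

namespace IsEdgeSeparation

variable {u v : V} {U S : Finset V}

theorem symm (h : G.IsEdgeSeparation u v U S) : G.IsEdgeSeparation v u (U ∪ S)ᶜ S where
  mem := by simp [h.right_notMem, h.right_notMem']
  card_eq := h.card_eq
  notMem_of_mem x hx := by simp at hx; exact hx.2
  right_notMem := by simp [h.mem]
  right_notMem' := h.notMem_of_mem u h.mem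
  closed x hx y hxy := by
    simp only [Finset.compl_union, Finset.mem_inter, Finset.mem_compl] at hx ⊢
    by_cases hyS : y ∈ S
    · simp [hyS]
    by_cases hyU : y ∈ U
    · rcases h.closed y hyU x hxy.symm with h1 | h1 | h1
      · exact absurd h1 hx.1
      · exact absurd h1 hx.2
      · exact Or.inr (Or.inr ⟨h1.2, h1.1⟩)
    · exact Or.inl ⟨hyU, hyS⟩

theorem neighborFinset_subset (h : G.IsEdgeSeparation u v U S) :
    G.neighborFinset u ⊆ U.erase u ∪ insert v S := fun y hy => by
  rw [mem_neighborFinset] at hy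
  have := h.closed u h.mem y hy
  have hne := hy.ne'
  simp only [Finset.mem_union, Finset.mem_erase, Finset.mem_insert]
  tauto

theorem degree_le (h : G.IsEdgeSeparation u v U S) : G.degree u ≤ U.card + 2 := by
  rw [← h.card_union, ← card_neighborFinset_eq_degree]
  exact Finset.card_le_card h.neighborFinset_subset

theorem exists_adj_mem (h : G.IsEdgeSeparation u v U S) (hu : 4 ≤ G.degree u) :
    ∃ y ∈ U, y ≠ u ∧ G.Adj u y := by
  by_contra! hcon
  have hsub : G.neighborFinset u ⊆ insert v S := fun y hy => by
    rcases Finset.mem_union.1 (h.neighborFinset_subset hy) with h1 | h1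
    · rw [mem_neighborFinset] at hy
      exact absurd hy (hcon y (Finset.mem_of_mem_erase h1) (Finset.ne_of_mem_erase h1))
    · exact h1
  have := Finset.card_le_card hsub
  rw [Finset.card_insert_of_notMem h.right_notMem', h.card_eq,
    card_neighborFinset_eq_degree] at this
  omega

end IsEdgeSeparation

theorem IsMinimallyKConnected.exists_isEdgeSeparation (h : G.IsMinimallyKConnected 3) {u v : V}
    (huv : G.Adj u v) : ∃ U S : Finset V, G.IsEdgeSeparation u v U S := by
  -- a disconnecting set of the graph without the edge, and a component of what remains
  have hnot := h.2 s(u, v) (by simpa using huv)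
  rw [IsKConnected, not_and] at hnot
  have hnot := hnot h.1.1
  push Not at hnot
  obtain ⟨S, hS, hdis⟩ := hnot
  have hne : Nonempty ((S : Set V)ᶜ : Set V) := by
    have h1 : ∃ x, x ∉ S := by
      by_contra! hall
      have h2 : Fintype.card V ≤ S.card := by
        rw [← Finset.card_univ]
        exact Finset.card_le_card fun x _ => hall x
      have := h.1.1
      omega
    obtain ⟨x, hx⟩ := h1
    exact ⟨⟨x, by simpa using hx⟩⟩
  rw [connected_iff, not_and_or, Preconnected] at hdis
  have hdis := hdis.resolve_right (fun hc => hc hne)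
  push Not at hdis
  obtain ⟨p, q, hpq⟩ := hdis
  set G' := (G.deleteEdges {s(u, v)}).induce ((S : Set V)ᶜ) with hG'
  set C : Finset V := Finset.univ.filter
    fun x => ∃ hx : x ∈ ((S : Set V)ᶜ : Set V), G'.Reachable p ⟨x, hx⟩ with hC
  have hpC : (p : V) ∈ C := by
    simp only [hC, Finset.mem_filter, Finset.mem_univ, true_and]
    exact ⟨p.2, Reachable.refl _⟩
  have hqC : (q : V) ∉ C := by
    simp only [hC, Finset.mem_filter, Finset.mem_univ, true_and]
    rintro ⟨hx, hr⟩
    exact hpq hr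
  have hCS : ∀ x ∈ C, x ∉ S := by
    intro x hx
    simp only [hC, Finset.mem_filter, Finset.mem_univ, true_and] at hx
    simpa using hx.1
  have hcl : ∀ x ∈ C, ∀ y, G.Adj x y → y ∈ C ∨ y ∈ S ∨ (x = u ∧ y = v) ∨ (x = v ∧ y = u) := by
    intro x hx y hxy
    by_cases hyS : y ∈ S
    · exact Or.inr (Or.inl hyS)
    by_cases he : s(x, y) = s(u, v)
    · rw [Sym2.eq_iff] at he
      exact Or.inr (Or.inr he)
    left
    simp only [hC, Finset.mem_filter, Finset.mem_univ, true_and] at hx ⊢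
    obtain ⟨hx1, hr⟩ := hx
    refine ⟨by simpa using hyS, hr.trans (Adj.reachable ?_)⟩
    simp [hG', hxy, he]
  -- otherwise `S` would already disconnect `G`
  have hcross : (u ∈ C ∧ v ∉ C ∧ v ∉ S) ∨ (v ∈ C ∧ u ∉ C ∧ u ∉ S) := by
    by_contra hcon
    have := h.1.mem_or_mem hS hpC (hCS p hpC) (fun x hx y hxy => by
      rcases hcl x hx y hxy with h1 | h1 | ⟨rfl, rfl⟩ | ⟨rfl, rfl⟩ <;> tauto) q
    rcases this with h1 | h1
    exacts [hqC h1, q.2 (by simpa using h1)]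
  obtain ⟨U, huU, hUS, hvU, hvS, hUcl⟩ : ∃ U : Finset V, u ∈ U ∧ (∀ x ∈ U, x ∉ S) ∧ v ∉ U ∧
      v ∉ S ∧ ∀ x ∈ U, ∀ y, G.Adj x y → y ∈ U ∨ y ∈ S ∨ (x = u ∧ y = v) := by
    rcases hcross with ⟨hu, hv, hvS⟩ | ⟨hv, hu, huS⟩
    · refine ⟨C, hu, hCS, hv, hvS, fun x hx y hxy => ?_⟩
      rcases hcl x hx y hxy with h1 | h1 | h1 | ⟨rfl, rfl⟩
      exacts [Or.inl h1, Or.inr (Or.inl h1), Or.inr (Or.inr h1), absurd hx hv]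
    · refine ⟨(C ∪ S)ᶜ, by simp [hu, huS], fun x hx => ?_, by simp [hv], hCS v hv,
        fun x hx y hxy => ?_⟩
      · simp at hx; exact hx.2
      · simp only [Finset.compl_union, Finset.mem_inter, Finset.mem_compl] at hx ⊢
        by_cases hyC : y ∈ C
        · rcases hcl y hyC x hxy.symm with h1 | h1 | ⟨rfl, rfl⟩ | ⟨rfl, rfl⟩
          exacts [absurd h1 hx.1, absurd h1 hx.2, absurd hyC hu, by simp]
        · tauto
  refine ⟨U, S, huU, ?_, hUS, hvU, hvS, hUcl⟩
  -- with a smaller `S`, adding `u` to it gives a disconnecting set of `G`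
  by_contra hcard
  have hS1 : S.card ≤ 1 := by omega
  have hU : ∀ x ∈ U, x = u := by
    by_contra! hx
    obtain ⟨x, hx, hxu⟩ := hx
    have hc : (insert u S).card < 3 := (Finset.card_insert_le _ _).trans_lt (by omega)
    have := h.1.mem_or_mem (U := U.erase u) hc (u := x) (by simp [hx, hxu])
      (by simp [hxu, hUS x hx]) (fun y hy z hyz => by
        have hyu := Finset.ne_of_mem_erase hy
        rcases hUcl y (Finset.mem_of_mem_erase hy) z hyz with h1 | h1 | h1
        · by_cases hzu : z = u
          · simp [hzu]
          · simp [hzu, h1]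
        · simp [h1]
        · exact absurd h1.1 hyu) v
    rcases this with h1 | h1
    · exact hvU (Finset.mem_of_mem_erase h1)
    · rcases Finset.mem_insert.1 h1 with h2 | h2
      exacts [huv.ne h2.symm, hvS h2]
  have hsub : G.neighborFinset u ⊆ insert v S := fun y hy => by
    rw [mem_neighborFinset] at hy
    rcases hUcl u huU y hy with h1 | h1 | h1
    · exact absurd (hU y h1) hy.ne'
    · simp [h1]
    · simp [h1.2]
  have h1 := (Finset.card_le_card hsub).trans (Finset.card_insert_le _ _)
  rw [card_neighborFinset_eq_degree] at h1
  have := h.1.three_le_degree u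
  omega

/-- If `v` is adjacent to all vertices outside `U`, then every neighbour `x ≠ u` of `v` has
degree three: for a neighbour of larger degree, the part of a separation for `xv` that contains
`x` would, but for `x`, lie inside `U \ {u}`, and two vertices would separate it from `v`. -/
theorem IsMinimallyKConnected.degree_le_three_of_forall_adj (h : G.IsMinimallyKConnected 3)
    {u v : V} {U S : Finset V} (huv : G.Adj u v) (hs : G.IsEdgeSeparation u v U S)
    (hv : ∀ y, y ∉ U → y ≠ v → G.Adj v y) (hc : ∃ c, c ∉ U ∧ c ∉ S ∧ c ≠ v) {x : V}
    (hvx : G.Adj v x) (hxu : x ≠ u) : G.degree x ≤ 3 := by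
  by_contra! hdeg
  obtain ⟨X, T, hX⟩ := h.exists_isEdgeSeparation hvx.symm
  -- non-neighbours of `v` lie in `U \ {u}`
  have hnon : ∀ y ∈ X, y ≠ x → y ∈ U ∧ y ≠ u := by
    intro y hy hyx
    have hna := hX.not_adj_right hy hyx
    refine ⟨by_contra fun hyU => hna (hv y hyU (hX.ne_right hy)).symm, ?_⟩
    rintro rfl
    exact hna huv
  obtain ⟨y, hyX, hyx, hxy⟩ := hX.exists_adj_mem hdeg
  obtain ⟨hyU, hyu⟩ := hnon y hyX hyx
  have hxU : x ∉ U := fun hxU => hs.not_adj_right hxU hxu hvx.symm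
  have hxS : x ∈ S := by
    by_contra hxS
    exact hs.not_adj hyU hxU hxS hvx.ne' hxy.symm
  -- `x` has a neighbour `c` on the side of `v`
  obtain ⟨c, hcU, hcS, hcv, hxc⟩ : ∃ c, c ∉ U ∧ c ∉ S ∧ c ≠ v ∧ G.Adj x c := by
    by_contra! hcon
    obtain ⟨c, hcU, hcS, hcv⟩ := hc
    have hcard : (insert v (S.erase x)).card < 3 := by
      refine (Finset.card_insert_le _ _).trans_lt ?_
      rw [Finset.card_erase_of_mem hxS, hs.card_eq]
      norm_num
    have := h.1.mem_or_mem (U := (U ∪ S)ᶜ.erase v) (S := insert v (S.erase x)) (u := c) hcard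
      (by simp [hcU, hcS, hcv]) (by simp [hcS, hcv]) (fun z hz t hzt => by
        simp only [Finset.compl_union, Finset.mem_erase, Finset.mem_inter, Finset.mem_compl]
          at hz
        have htU : t ∉ U := fun htU => hs.not_adj htU hz.2.1 hz.2.2 hz.1 hzt.symm
        have htx : t ≠ x := by
          rintro rfl
          exact hcon z hz.2.1 hz.2.2 hz.1 hzt.symm
        simp only [Finset.compl_union, Finset.mem_erase, Finset.mem_inter, Finset.mem_compl,
          Finset.mem_insert]
        tauto) u
    have huS := hs.notMem_of_mem u hs.mem
    simp [hs.mem, huv.ne, huS] at this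
  have hcX : c ∉ X := fun hcX => hcU (hnon c hcX hxc.ne').1
  have hcT : c ∈ T := by
    rcases hX.closed x hX.mem c hxc with h1 | h1 | h1
    exacts [absurd h1 hcX, h1, absurd h1.2 hcv]
  -- no vertex of `X \ {x}` is adjacent to `c`, so `x` and the other vertex of `T` cut it off
  have hcard : (insert x (T.erase c)).card < 3 := by
    refine (Finset.card_insert_le _ _).trans_lt ?_
    rw [Finset.card_erase_of_mem hcT, hX.card_eq]
    norm_num
  have := h.1.mem_or_mem (U := X.erase x) (S := insert x (T.erase c)) (u := y) hcard
    (by simp [hyX, hyx]) (by simp [hyx, hX.notMem_of_mem y hyX]) (fun z hz t hzt => by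
      have hzx := Finset.ne_of_mem_erase hz
      have hzX := Finset.mem_of_mem_erase hz
      have htc : t ≠ c := by
        rintro rfl
        exact hs.not_adj (hnon z hzX hzx).1 hcU hcS hcv hzt
      have := hX.closed z hzX t hzt
      simp only [Finset.mem_erase, Finset.mem_insert]
      tauto) v
  simp [hX.right_notMem, hX.right_notMem', hvx.ne] at this

/-- If `x` and `y` are neighbours of a vertex `w` of degree three and have, besides `w` and a
fourth vertex `v`, only neighbours in common with `w`, then `x = y`: otherwise `v` and the third
neighbour of `w` would cut off `{w, x, y}`. -/
theorem IsKConnected.eq_of_neighbors_subset (h : G.IsKConnected 3)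
    (hn : 6 ≤ Fintype.card V) {v w x y : V} (hw : G.degree w ≤ 3) (hvw : v ≠ w)
    (hwx : G.Adj w x) (hwy : G.Adj w y) (hvx : v ≠ x) (hvy : v ≠ y)
    (hx : ∀ z, G.Adj x z → z = w ∨ z = v ∨ G.Adj w z)
    (hy : ∀ z, G.Adj y z → z = w ∨ z = v ∨ G.Adj w z) : x = y := by
  by_contra hxy
  set R := ((G.neighborFinset w).erase x).erase y
  have hR : R.card ≤ 1 := by
    rw [Finset.card_erase_of_mem, Finset.card_erase_of_mem, card_neighborFinset_eq_degree]
    · omega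
    · simpa using hwx
    · simp [hwy, Ne.symm hxy]
  have hcard : (insert v R).card ≤ 2 := (Finset.card_insert_le _ _).trans (by omega)
  have hall := h.mem_or_mem (U := {w, x, y}) (S := insert v R) (u := w) (by omega) (by simp)
    (by simp [R, hvw.symm]) (fun a ha b hab => by
      have hb : b = w ∨ b = v ∨ G.Adj w b := by
        simp only [Finset.mem_insert, Finset.mem_singleton] at ha
        rcases ha with rfl | rfl | rfl
        exacts [Or.inr (Or.inr hab), hx b hab, hy b hab]
      simp only [Finset.mem_insert, Finset.mem_singleton, R, Finset.mem_erase,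
        mem_neighborFinset]
      tauto)
  have hsub : (Finset.univ : Finset V) ⊆ {w, x, y} ∪ insert v R := fun z _ => by
    rw [Finset.mem_union]; exact hall z
  have h1 := (Finset.card_le_card hsub).trans (Finset.card_union_le _ _)
  have h3 : ({w, x, y} : Finset V).card ≤ 3 := Finset.card_le_three
  rw [Finset.card_univ] at h1
  omega

end MinimallyThreeConnected

/-! ### Degrees of the neighbours of a vertex -/

section DegreeConditions

open Classical

variable {V : Type*} [Fintype V] {G : SimpleGraph V}

theorem IsMinimallyKConnected.degree_le_three_of_dominating (h : G.IsMinimallyKConnected 3)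
    {v x : V} (hv : ∀ y, y ≠ v → G.Adj v y) (hx : x ≠ v) : G.degree x ≤ 3 := by
  by_contra! hdeg
  obtain ⟨U, S, hs⟩ := h.exists_isEdgeSeparation (hv x hx).symm
  obtain ⟨y, hy, hyx, -⟩ := hs.exists_adj_mem hdeg
  exact hs.not_adj_right hy hyx (hv y (hs.ne_right hy)).symm

/-- No vertex of a minimally `3`-connected graph has exactly one non-neighbour. -/
theorem IsMinimallyKConnected.false_of_unique_not_adj (h : G.IsMinimallyKConnected 3)
    (hn : 7 ≤ Fintype.card V) {v w : V} (hwv : w ≠ v) (hvw : ¬ G.Adj v w)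
    (hv : ∀ y, y ≠ v → y ≠ w → G.Adj v y) : False := by
  -- a neighbour of `v` of degree at least four shares its neighbours, but for `v`, with `w`
  have hbig : ∀ x, G.Adj v x → 4 ≤ G.degree x → G.degree w ≤ 3 ∧ G.Adj w x ∧
      ∃ a b, a ≠ b ∧ (∀ z, G.Adj x z ↔ z = w ∨ z = v ∨ z = a ∨ z = b) ∧
        (∀ z, G.Adj w z ↔ z = x ∨ z = a ∨ z = b) := by
    intro x hvx hdeg
    obtain ⟨U, S, hs⟩ := h.exists_isEdgeSeparation hvx.symm
    obtain ⟨y, hy, hyx, hxy⟩ := hs.exists_adj_mem hdeg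
    have hU : ∀ y ∈ U, y = x ∨ y = w := by
      intro y hy
      by_contra! hcon
      exact hs.not_adj_right hy hcon.1 (hv y (hs.ne_right hy) hcon.2).symm
    obtain rfl : y = w := (hU y hy).resolve_left hyx
    obtain ⟨a, b, hab, rfl⟩ := Finset.card_eq_two.1 hs.card_eq
    have hxa : G.neighborFinset x ⊆ {y, v, a, b} := fun z hz => by
      rw [mem_neighborFinset] at hz
      have h1 := hs.closed x hs.mem z hz
      have h2 := hU z
      have h3 := hz.ne'
      simp only [Finset.mem_insert, Finset.mem_singleton] at h1 ⊢
      tauto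
    have hwa : G.neighborFinset y ⊆ {x, a, b} := fun z hz => by
      rw [mem_neighborFinset] at hz
      have h1 := hs.closed y hy z hz
      have h2 := hU z
      have h3 := hz.ne'
      simp only [Finset.mem_insert, Finset.mem_singleton] at h1 ⊢
      tauto
    have hxe := Finset.eq_of_subset_of_card_le hxa
      (Finset.card_le_four.trans (by rwa [card_neighborFinset_eq_degree]))
    have hwe := Finset.eq_of_subset_of_card_le hwa
      (Finset.card_le_three.trans
        (by rw [card_neighborFinset_eq_degree]; exact h.1.three_le_degree y))
    refine ⟨?_, hxy.symm, a, b, hab, fun z => ?_, fun z => ?_⟩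
    · rw [← card_neighborFinset_eq_degree, hwe]; exact Finset.card_le_three
    · rw [← mem_neighborFinset, hxe]; simp
    · rw [← mem_neighborFinset, hwe]; simp
  have huniq : ∀ x y, G.Adj v x → 4 ≤ G.degree x → G.Adj v y → 4 ≤ G.degree y → x = y := by
    intro x y hvx hx hvy hy
    obtain ⟨hw, hwx, a, b, -, hxz, hwz⟩ := hbig x hvx hx
    obtain ⟨-, hwy, a', b', -, hyz, hwz'⟩ := hbig y hvy hy
    refine h.1.eq_of_neighbors_subset (by omega) hw hwv.symm hwx hwy hvx.ne hvy.ne ?_ ?_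
    · intro z hz
      rw [hxz] at hz
      rw [hwz]; tauto
    · intro z hz
      rw [hyz] at hz
      rw [hwz']; tauto
  have hsmall : ∀ x, G.Adj v x → G.degree x ≤ 3 := by
    intro x hvx
    by_contra! hx
    obtain ⟨hw, hwx, a, b, hab, hxz, hwz⟩ := hbig x hvx hx
    -- both common neighbours of `x` and `w` are adjacent to `v`, `w`, `x` and to nothing else
    have hcom : ∀ a, a ≠ v → G.Adj x a → G.Adj w a → ∀ z, G.Adj a z → z = w ∨ z = x ∨ z = v := by
      intro a hav hxa hwa z hz
      have hva : G.Adj v a := hv a hav hwa.ne'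
      have hda : G.degree a ≤ 3 := by
        by_contra! hda
        exact hxa.ne (huniq x a hvx hx hva hda)
      have hsub : ({w, x, v} : Finset V) ⊆ G.neighborFinset a := by
        intro t ht
        simp only [Finset.mem_insert, Finset.mem_singleton] at ht
        rw [mem_neighborFinset]
        rcases ht with rfl | rfl | rfl
        exacts [hwa.symm, hxa.symm, hva.symm]
      have hc : ({w, x, v} : Finset V).card = 3 :=
        Finset.card_eq_three.2 ⟨w, x, v, hwx.ne, hwv, hvx.ne', rfl⟩
      have he := Finset.eq_of_subset_of_card_le hsub
        (by rw [hc, card_neighborFinset_eq_degree]; exact hda)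
      have : z ∈ G.neighborFinset a := by simpa using hz
      rw [← he] at this
      simpa using this
    have hav : a ≠ v := by rintro rfl; exact hvw ((hwz a).2 (by simp)).symm
    have hbv : b ≠ v := by rintro rfl; exact hvw ((hwz b).2 (by simp)).symm
    have ha := hcom a hav ((hxz a).2 (by simp)) ((hwz a).2 (by simp))
    have hb := hcom b hbv ((hxz b).2 (by simp)) ((hwz b).2 (by simp))
    have hall := h.1.mem_or_mem (U := {w, x, a, b}) (S := {v}) (u := w) (by simp) (by simp)
      (by simpa using hwv) (fun s hs t hst => by
        simp only [Finset.mem_insert, Finset.mem_singleton] at hs ⊢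
        rcases hs with rfl | rfl | rfl | rfl
        · rw [hwz] at hst; tauto
        · rw [hxz] at hst; tauto
        · have := ha t hst; tauto
        · have := hb t hst; tauto)
    have hsub : (Finset.univ : Finset V) ⊆ {w, x, a, b} ∪ {v} := fun z _ => by
      rw [Finset.mem_union]; exact hall z
    have h1 := (Finset.card_le_card hsub).trans (Finset.card_union_le _ _)
    have h3 : ({w, x, a, b} : Finset V).card ≤ 4 := Finset.card_le_four
    rw [Finset.card_univ, Finset.card_singleton] at h1
    omega
  -- count the edges of the connected graph `G - v - w`
  set T : Set V := ((({v, w} : Finset V) : Set V)ᶜ) with hT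
  set H := G.induce T with hH
  have hTmem : ∀ x, x ∈ T ↔ x ≠ v ∧ x ≠ w := by intro x; simp [hT]
  have hpair : ({v, w} : Finset V).card = 2 := Finset.card_pair hwv.symm
  have hconn : H.Connected := h.1.2 {v, w} (by omega)
  have hedge := hconn.card_vert_le_card_edgeSet_add_one
  have hcardT : Fintype.card T + 2 = Fintype.card V := by
    have := Finset.card_compl_add_card ({v, w} : Finset V)
    rw [hpair] at this
    rw [← this, ← Set.toFinset_card]
    congr 2
    ext x
    simp [hT]
  rw [Nat.card_eq_fintype_card, Nat.card_eq_fintype_card, ← edgeFinset_card] at hedge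
  have hsum := H.sum_degrees_eq_twice_card_edges
  have hdegH : ∀ x : T, H.degree x + (if G.Adj w x then 1 else 0) ≤ 2 := by
    intro x
    obtain ⟨hxv, hxw⟩ := (hTmem x).1 x.2
    have hvx := hv x hxv hxw
    have h1 : ((H.neighborFinset x).map (Function.Embedding.subtype _)) ∪
        (insert v (if G.Adj w x then {w} else ∅)) ⊆ G.neighborFinset x := by
      intro z hz
      rw [mem_neighborFinset]
      rcases Finset.mem_union.1 hz with hz | hz
      · obtain ⟨t, ht, rfl⟩ := Finset.mem_map.1 hz
        rw [mem_neighborFinset] at ht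
        exact ht
      · rcases Finset.mem_insert.1 hz with rfl | hz
        · exact hvx.symm
        · split_ifs at hz with hwx
          · rw [Finset.mem_singleton] at hz
            subst hz; exact hwx.symm
          · simp at hz
    have h2 := Finset.card_le_card h1
    have hwv' : v ∉ (if G.Adj w x then {w} else ∅ : Finset V) := by
      split_ifs <;> simp [hwv.symm]
    rw [Finset.card_union_of_disjoint, Finset.card_map, Finset.card_insert_of_notMem hwv',
      card_neighborFinset_eq_degree, card_neighborFinset_eq_degree] at h2
    · have := hsmall x hvx
      split_ifs at h2 ⊢ <;> simp at h2 <;> omega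
    · rw [Finset.disjoint_left]
      intro z hz hz'
      obtain ⟨t, -, rfl⟩ := Finset.mem_map.1 hz
      have ht := (hTmem t).1 t.2
      rcases Finset.mem_insert.1 hz' with h3 | h3
      · exact ht.1 h3
      · split_ifs at h3
        · exact ht.2 (by simpa using h3)
        · simp at h3
  have hwdeg : ∑ x : T, (if G.Adj w x then 1 else 0) = G.degree w := by
    rw [← card_neighborFinset_eq_degree, ← Finset.card_filter]
    refine Finset.card_bij (fun x _ => (x : V)) (fun x hx => by simpa using hx)
      (fun x _ y _ hxy => Subtype.ext hxy) (fun y hy => ?_)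
    rw [mem_neighborFinset] at hy
    exact ⟨⟨y, (hTmem y).2 ⟨by rintro rfl; exact hvw hy.symm, hy.ne'⟩⟩, by simpa using hy, rfl⟩
  have htot := Finset.sum_le_sum fun (x : T) (_ : x ∈ Finset.univ) => hdegH x
  rw [Finset.sum_add_distrib, hsum, hwdeg, Finset.sum_const, Finset.card_univ, smul_eq_mul]
    at htot
  have := h.1.three_le_degree w
  omega

/-- If `u` is a neighbour of `v` with `d(u) + d(v) ≥ n + 1`, and both degrees are at least four,
then at most one neighbour of `v` besides `u` has degree more than three, and its degree is four.
For a separation `(U, S)` of `uv`, the degrees are at most `|U| + 2` and `n - |U|`, so at most one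
adjacency that these bounds allow is missing. If none is missing at `v`, all neighbours of `v`
but `u` have degree three. If `v` misses `w`, then none is missing at `u`, so that the vertices
of `S` have degree three, and a neighbour of `v` of degree four has the same neighbours as `w`,
but for `v`, `w` and itself. -/
theorem IsMinimallyKConnected.sum_degree_neighborFinset_lt (h : G.IsMinimallyKConnected 3)
    (hn : 7 ≤ Fintype.card V) {u v : V} (huv : G.Adj u v) (hu : 4 ≤ G.degree u)
    (hv : 4 ≤ G.degree v) (hlarge : Fintype.card V + 1 ≤ G.degree u + G.degree v) :
    ∑ x ∈ G.neighborFinset v, G.degree x + 1 ≤ 2 * G.degree v + Fintype.card V := by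
  obtain ⟨U, S, hs⟩ := h.exists_isEdgeSeparation huv
  have hdu := hs.degree_le
  have huN : u ∈ G.neighborFinset v := by simpa using huv.symm
  have hsplit := Finset.add_sum_erase _ (fun x => G.degree x) huN
  -- the vertices of `U \ {u}` are not adjacent to `v`
  have hdisj : Disjoint (U.erase u) (insert v (G.neighborFinset v)) := by
    rw [Finset.disjoint_left]
    intro x hx hx'
    have hxU := Finset.mem_of_mem_erase hx
    rcases Finset.mem_insert.1 hx' with rfl | h1
    · exact hs.right_notMem hxU
    · rw [mem_neighborFinset] at h1
      exact hs.not_adj_right hxU (Finset.ne_of_mem_erase hx) h1.symm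
  have hvN : v ∉ G.neighborFinset v := by simp
  have hUpos := Finset.card_pos.2 ⟨u, hs.mem⟩
  have hcard : (U.erase u ∪ insert v (G.neighborFinset v)).card = U.card + G.degree v := by
    rw [Finset.card_union_of_disjoint hdisj, Finset.card_erase_of_mem hs.mem,
      Finset.card_insert_of_notMem hvN, card_neighborFinset_eq_degree]
    omega
  have hthree : ∀ s : Finset V, (∀ x ∈ s, G.degree x ≤ 3) → ∑ x ∈ s, G.degree x ≤ s.card * 3 :=
    fun s hs => Finset.sum_le_card_nsmul s _ 3 hs
  by_cases hfull : ∀ y, y ∉ U → y ≠ v → G.Adj v y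
  · have hle : U.card + G.degree v ≤ Fintype.card V := by
      rw [← hcard]; exact Finset.card_le_univ _
    obtain ⟨c, hc⟩ : ∃ c, c ∉ U ∧ c ∉ S ∧ c ≠ v := by
      obtain ⟨c, hc, hcv, -⟩ := hs.symm.exists_adj_mem hv
      simp at hc
      exact ⟨c, hc.1, hc.2, hcv⟩
    have h1 := hthree ((G.neighborFinset v).erase u) fun x hx => by
      refine h.degree_le_three_of_forall_adj huv hs hfull ⟨c, hc⟩ (x := x) ?_
        (Finset.ne_of_mem_erase hx)
      simpa using Finset.mem_of_mem_erase hx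
    rw [Finset.card_erase_of_mem huN, card_neighborFinset_eq_degree] at h1
    omega
  · push Not at hfull
    obtain ⟨w, hwU, hwv, hvw⟩ := hfull
    have hwn : w ∉ U.erase u ∪ insert v (G.neighborFinset v) := by
      simp [hwU, hwv, hvw]
    have hcard' := Finset.card_insert_of_notMem hwn
    rw [hcard] at hcard'
    have hle : U.card + G.degree v + 1 ≤ Fintype.card V := by
      rw [← hcard']; exact Finset.card_le_univ _
    -- all estimates are now equalities: `u` is adjacent to all of `U` and `S`, and `w` is the
    -- only vertex outside `U` that is not adjacent to `v`
    have hNu : G.neighborFinset u = U.erase u ∪ insert v S :=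
      Finset.eq_of_subset_of_card_le hs.neighborFinset_subset (by
        rw [hs.card_union, card_neighborFinset_eq_degree]; omega)
    have huniv : insert w (U.erase u ∪ insert v (G.neighborFinset v)) = Finset.univ := by
      rw [← Finset.card_eq_iff_eq_univ, hcard']
      omega
    have hnon : ∀ y, y ≠ v → ¬ G.Adj v y → y ∈ U ∨ y = w := by
      intro y hyv hy
      have := Finset.mem_univ y
      rw [← huniv] at this
      simp [hyv, hy] at this
      tauto
    have hSdeg : ∀ x ∈ S, G.degree x ≤ 3 := by
      intro x hxS
      have hadj : ∀ y, y ∉ (U ∪ S)ᶜ → y ≠ u → G.Adj u y := by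
        intro y hy hyu
        rw [← mem_neighborFinset, hNu]
        simp at hy ⊢
        tauto
      obtain ⟨c, hc, hcu, -⟩ := hs.exists_adj_mem hu
      refine h.degree_le_three_of_forall_adj huv.symm hs.symm hadj
        ⟨c, by simp [hc], hs.notMem_of_mem c hc, hcu⟩ (x := x) ?_ ?_
      · rw [← mem_neighborFinset, hNu]; simp [hxS]
      · rintro rfl; exact hs.right_notMem' hxS
    have hbig : ∀ x, G.Adj v x → x ≠ u → 4 ≤ G.degree x → G.degree x ≤ 4 ∧ G.Adj w x ∧
        G.degree w ≤ 3 ∧ ∀ z, G.Adj x z → z = w ∨ z = v ∨ G.Adj w z := by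
      intro x hvx hxu hx
      have hxU : x ∉ U := fun hxU => hs.not_adj_right hxU hxu hvx.symm
      have hxS : x ∉ S := fun hxS => by have := hSdeg x hxS; omega
      obtain ⟨X, T, hX⟩ := h.exists_isEdgeSeparation hvx.symm
      obtain ⟨y, hyX, hyx, hxy⟩ := hX.exists_adj_mem hx
      have hXnon : ∀ z ∈ X, z ≠ x → z ∈ U ∨ z = w := fun z hz hzx =>
        hnon z (hX.ne_right hz) fun hadj => hX.not_adj_right hz hzx hadj.symm
      have hXadj : ∀ z ∈ X, G.Adj x z → z = w := by
        intro z hz hxz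
        refine (hXnon z hz hxz.ne').resolve_left fun hzU => ?_
        exact hs.not_adj hzU hxU hxS hvx.ne' hxz.symm
      obtain rfl := hXadj y hyX hxy
      have hyS : y ∉ S := by
        intro hyS
        have huy : G.Adj u y := by
          rw [← mem_neighborFinset, hNu]; simp [hyS]
        rcases hX.closed y hyX u huy.symm with h1 | h1 | h1
        · exact hX.not_adj_right h1 hxu.symm huv
        · -- equality in the degree bound for `x` makes `x` adjacent to all of `T`
          have hsub : G.neighborFinset x ⊆ insert y (insert v (T.erase u)) := by
            intro z hz
            rw [mem_neighborFinset] at hz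
            have h2 := hX.closed x hX.mem z hz
            have h3 := hXadj z
            have h4 : z ≠ u := by
              rintro rfl
              exact hs.not_adj hs.mem hxU hxS hvx.ne' hz.symm
            simp only [Finset.mem_insert, Finset.mem_erase]
            tauto
          have h2 := Finset.card_le_card hsub
          have h3 := (Finset.card_insert_le y (insert v (T.erase u))).trans
            (Nat.add_le_add_right (Finset.card_insert_le _ _) 1)
          rw [Finset.card_erase_of_mem h1, hX.card_eq] at h3
          rw [card_neighborFinset_eq_degree] at h2
          omega
        · exact hyx h1.1
      have hNx : G.neighborFinset x ⊆ insert y (insert v T) := by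
        intro z hz
        rw [mem_neighborFinset] at hz
        have h2 := hX.closed x hX.mem z hz
        have h3 := hXadj z
        simp only [Finset.mem_insert]
        tauto
      have hNy : G.neighborFinset y ⊆ insert x T := by
        intro z hz
        rw [mem_neighborFinset] at hz
        rcases hX.closed y hyX z hz with h2 | h2 | h2
        · by_cases hzx : z = x
          · simp [hzx]
          · rcases hXnon z h2 hzx with h3 | h3
            · exact absurd hz.symm (hs.not_adj h3 hwU hyS hwv)
            · exact absurd h3 hz.ne'
        · simp [h2]
        · exact absurd h2.1 hyx
      have hT3 : (insert x T).card ≤ 3 := (Finset.card_insert_le _ _).trans (by rw [hX.card_eq])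
      have hNye := Finset.eq_of_subset_of_card_le hNy (hT3.trans
        (by rw [card_neighborFinset_eq_degree]; exact h.1.three_le_degree y))
      refine ⟨?_, hxy.symm, ?_, fun z hz => ?_⟩
      · rw [← card_neighborFinset_eq_degree]
        refine (Finset.card_le_card hNx).trans ((Finset.card_insert_le _ _).trans ?_)
        have := Finset.card_insert_le v T
        rw [hX.card_eq] at this
        omega
      · rw [← card_neighborFinset_eq_degree]
        exact (Finset.card_le_card hNy).trans hT3
      · have : z ∈ G.neighborFinset x := by simpa using hz
        have := hNx this
        rw [← mem_neighborFinset, hNye]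
        simp only [Finset.mem_insert] at this ⊢
        tauto
    by_cases hex : ∃ x, G.Adj v x ∧ x ≠ u ∧ 4 ≤ G.degree x
    · obtain ⟨x, hvx, hxu, hx⟩ := hex
      obtain ⟨hx4, hwx, hw3, hxz⟩ := hbig x hvx hxu hx
      have hxN : x ∈ (G.neighborFinset v).erase u := by simp [hxu, hvx]
      have hsplit' := Finset.add_sum_erase _ (fun x => G.degree x) hxN
      have h1 := hthree (((G.neighborFinset v).erase u).erase x) fun y hy => by
        by_contra! hy4
        simp only [Finset.mem_erase, mem_neighborFinset] at hy
        obtain ⟨-, hwy, -, hyz⟩ := hbig y hy.2.2 hy.2.1 hy4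
        exact hy.1 (h.1.eq_of_neighbors_subset (by omega) hw3 hwv.symm hwy hwx hy.2.2.ne hvx.ne
          hyz hxz)
      rw [Finset.card_erase_of_mem hxN, Finset.card_erase_of_mem huN,
        card_neighborFinset_eq_degree] at h1
      omega
    · push Not at hex
      have h1 := hthree ((G.neighborFinset v).erase u) fun x hx => by
        simp only [Finset.mem_erase, mem_neighborFinset] at hx
        have := hex x hx.2 hx.1
        omega
      rw [Finset.card_erase_of_mem huN, card_neighborFinset_eq_degree] at h1
      omega

theorem IsMinimallyKConnected.degree_add_three_le (h : G.IsMinimallyKConnected 3)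
    (hn : 7 ≤ Fintype.card V) (hdom : ∀ v, ∃ y, y ≠ v ∧ ¬ G.Adj v y) (v : V) :
    G.degree v + 3 ≤ Fintype.card V := by
  obtain ⟨w, hwv, hvw⟩ := hdom v
  obtain ⟨y, hyv, hyw, hvy⟩ : ∃ y, y ≠ v ∧ y ≠ w ∧ ¬ G.Adj v y := by
    by_contra! hcon
    exact h.false_of_unique_not_adj hn hwv hvw hcon
  have h1 : (insert y (insert w (insert v (G.neighborFinset v)))).card = G.degree v + 3 := by
    rw [Finset.card_insert_of_notMem, Finset.card_insert_of_notMem,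
      Finset.card_insert_of_notMem, card_neighborFinset_eq_degree] <;> simp [*]
  rw [← h1]
  exact Finset.card_le_univ _

/-- If no vertex is adjacent to all others, then the neighbours of `v` have average degree at most
`n - d(v)`, up to a total excess of two that can occur only for `d(v) = n - 3`. -/
theorem IsMinimallyKConnected.sum_degree_neighborFinset_le (h : G.IsMinimallyKConnected 3)
    (hn : 7 ≤ Fintype.card V) (hdom : ∀ v, ∃ y, y ≠ v ∧ ¬ G.Adj v y) (v : V) :
    ∑ x ∈ G.neighborFinset v, G.degree x ≤ G.degree v * (Fintype.card V - G.degree v) ∨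
      (G.degree v + 3 = Fintype.card V ∧
        ∑ x ∈ G.neighborFinset v, G.degree x ≤ 3 * G.degree v + 2) := by
  have hD := h.degree_add_three_le hn hdom
  by_cases hex : ∃ u, G.Adj v u ∧ Fintype.card V + 1 ≤ G.degree u + G.degree v
  · obtain ⟨u, hvu, hlarge⟩ := hex
    have hu := hD u
    have hv := hD v
    have h1 := h.sum_degree_neighborFinset_lt hn hvu.symm (by omega) (by omega) hlarge
    obtain ⟨k, hk⟩ := Nat.exists_eq_add_of_le hv
    rcases k with _ | k
    · right
      omega
    · left
      have h2 : Fintype.card V - G.degree v = k + 4 := by omega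
      rw [h2]
      have h3 : 4 ≤ G.degree v := by omega
      nlinarith
  · push Not at hex
    left
    rw [← card_neighborFinset_eq_degree]
    refine Finset.sum_le_card_nsmul _ _ _ fun u hu => ?_
    rw [mem_neighborFinset] at hu
    have := hex u hu
    rw [card_neighborFinset_eq_degree]
    omega

end DegreeConditions

/-! ### Wheels among the minimally `3`-connected graphs -/

section WheelRecognition

open Classical

theorem Connected.nonempty_iso_cycleGraph {V : Type*} [Fintype V] {G : SimpleGraph V}
    (hG : G.Connected) (hdeg : ∀ v, G.degree v = 2) :
    Nonempty (cycleGraph (Fintype.card V) ≃g G) := by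
  have hncard : ∀ v, (G.neighborSet v).ncard = 2 := fun v => by
    rw [← hdeg v, ← card_neighborFinset_eq_degree, ← Set.ncard_coe_finset, coe_neighborFinset]
  have hcyc : G.IsCycles := fun v _ => hncard v
  obtain ⟨v⟩ := hG.nonempty
  obtain ⟨p, hp, hverts⟩ := hcyc.exists_cycle_toSubgraph_verts_eq_connectedComponentSupp
    (v := v) (c := G.connectedComponentMk v) rfl
    (Set.nonempty_of_ncard_ne_zero (by rw [hncard]; norm_num))
  have hham : p.IsHamiltonianCycle := by
    rw [Walk.isHamiltonianCycle_iff_isCycle_and_support_count_tail_eq_one]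
    refine ⟨hp, fun a => List.count_eq_one_of_mem hp.support_nodup ?_⟩
    have ha : a ∈ p.support := by
      rw [← Walk.mem_verts_toSubgraph, hverts]
      exact ConnectedComponent.sound (hG.preconnected a v)
    rw [← Walk.cons_tail_support, List.mem_cons] at ha
    rcases ha with rfl | ha
    exacts [Walk.end_mem_tail_support hp.not_nil, ha]
  have hlen := hham.length_eq
  have h3 : 2 < Fintype.card V := hlen ▸ hp.three_le_length
  obtain ⟨f⟩ := (cycleGraph_isContained_iff (G := G) h3).2 ⟨v, p, hp, hlen⟩
  have hbij : Function.Bijective f :=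
    (Fintype.bijective_iff_injective_and_card f).2 ⟨f.injective, by simp⟩
  refine ⟨⟨Equiv.ofBijective f hbij, fun {a b} => ⟨fun hab => ?_, f.toHom.map_adj⟩⟩⟩
  -- both neighbourhoods have two elements
  have hsub : ((cycleGraph (Fintype.card V)).neighborFinset a).map ⟨f, f.injective⟩
      ⊆ G.neighborFinset (f a) := by
    intro x hx
    obtain ⟨y, hy, rfl⟩ := Finset.mem_map.1 hx
    rw [mem_neighborFinset] at hy ⊢
    exact f.toHom.map_adj hy
  have htwo : (cycleGraph (Fintype.card V)).degree a = 2 := by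
    obtain ⟨k, hk⟩ := Nat.exists_eq_add_of_le' h3
    generalize Fintype.card V = m at *
    subst hk
    convert cycleGraph_degree_three_le (v := a)
  have heq := Finset.eq_of_subset_of_card_le hsub (by
    rw [Finset.card_map, card_neighborFinset_eq_degree, card_neighborFinset_eq_degree, hdeg,
      htwo])
  have hb : f b ∈ G.neighborFinset (f a) := by
    rw [mem_neighborFinset]; exact hab
  rw [← heq] at hb
  obtain ⟨c, hc, hcb⟩ := Finset.mem_map.1 hb
  rw [mem_neighborFinset] at hc
  rwa [f.injective hcb] at hc

/-- A minimally `3`-connected graph with a vertex adjacent to all others is a wheel. -/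
theorem IsMinimallyKConnected.nonempty_iso_wheelGraph {V : Type*} [Fintype V]
    {G : SimpleGraph V} (h : G.IsMinimallyKConnected 3) {v : V}
    (hv : ∀ y, y ≠ v → G.Adj v y) : Nonempty (G ≃g wheelGraph (Fintype.card V)) := by
  set T : Set V := ((({v} : Finset V) : Set V)ᶜ) with hT
  have hTmem : ∀ x, x ∈ T ↔ x ≠ v := by intro x; simp [hT]
  have hconn : (G.induce T).Connected := h.1.2 {v} (by simp)
  have hdeg : ∀ x : T, (G.induce T).degree x = 2 := by
    intro x
    have hxv := (hTmem x).1 x.2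
    have h3 : G.degree x = 3 :=
      le_antisymm (h.degree_le_three_of_dominating hv hxv) (h.1.three_le_degree _)
    have h1 : ((G.induce T).neighborFinset x).map (Function.Embedding.subtype _)
        = (G.neighborFinset x).erase v := by
      ext z
      simp only [Finset.mem_map, mem_neighborFinset, Finset.mem_erase]
      constructor
      · rintro ⟨t, ht, rfl⟩
        exact ⟨(hTmem t).1 t.2, ht⟩
      · rintro ⟨hz, hxz⟩
        exact ⟨⟨z, (hTmem z).2 hz⟩, hxz, rfl⟩
    have h2 := congrArg Finset.card h1
    rw [Finset.card_map, Finset.card_erase_of_mem (by simpa using (hv x hxv).symm),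
      card_neighborFinset_eq_degree, card_neighborFinset_eq_degree, h3] at h2
    exact h2
  have hcard : Fintype.card T = Fintype.card V - 1 := by
    have := Finset.card_compl ({v} : Finset V)
    rw [Finset.card_singleton] at this
    rw [← this, ← Set.toFinset_card]
    congr 1
    ext x
    simp [hT]
  obtain ⟨e⟩ := hconn.nonempty_iso_cycleGraph hdeg
  rw [hcard] at e
  let g : Fin 1 ⊕ Fin (Fintype.card V - 1) → V := Sum.elim (fun _ => v) (fun i => e i)
  have hne : ∀ i, (e i : V) ≠ v := fun i => (hTmem _).1 (e i).2
  have hbij : Function.Bijective g := by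
    constructor
    · rintro (i | i) (j | j) hij
      · rw [Subsingleton.elim i j]
      · exact absurd hij.symm (hne j)
      · exact absurd hij (hne i)
      · rw [e.injective (Subtype.ext hij)]
    · intro x
      by_cases hx : x = v
      · exact ⟨Sum.inl 0, hx.symm⟩
      · exact ⟨Sum.inr (e.symm ⟨x, (hTmem x).2 hx⟩), by simp [g]⟩
  refine ⟨RelIso.symm ⟨Equiv.ofBijective g hbij, fun {a b} => ?_⟩⟩
  rcases a with i | i <;> rcases b with j | j
  · simp [g, wheelGraph_adj_inl_inl]
  · exact iff_of_true (hv _ (hne j)) (wheelGraph_adj_inl_inr i j)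
  · exact iff_of_true (hv _ (hne i)).symm (wheelGraph_adj_inl_inr j i).symm
  · rw [wheelGraph_adj_inr_inr]
    exact e.map_adj_iff (v := i) (w := j)

end WheelRecognition

/-! ### Comparison of the `α`-indices -/

/-- The quadratic polynomial `(r - α (n - 1)) (r - (2 + α)) - (1 - α)² (n - 1)`, whose larger root
is `ρ_α(W_n)`, is negative at `r = α (n - 2) + 2 (1 - α) (n - 2) / (n - 3)`. With `m = n - 3`,
`β = 1 - α` and `γ = 2 α - 1`, its value there times `-m²` is
`2 (m + 2) (m - 1) β² - 2 m (m - 3) β γ + m² (m - 2) γ²`, which is positive for `m ≥ 4`. -/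
theorem wheel_quadratic_neg {α n : ℝ} (hn : 7 ≤ n) (h0 : 1 / 2 ≤ α) (h1 : α < 1) :
    (α * (n - 2) + 2 * (1 - α) * (n - 2) / (n - 3) - α * (n - 1)) *
      (α * (n - 2) + 2 * (1 - α) * (n - 2) / (n - 3) - (2 + α)) < (1 - α) ^ 2 * (n - 1) := by
  obtain ⟨m, rfl⟩ : ∃ m, n = m + 3 := ⟨n - 3, by ring⟩
  obtain ⟨β, rfl⟩ : ∃ β, α = 1 - β := ⟨1 - α, by ring⟩
  have hm : 4 ≤ m := by linarith
  have hβ : 0 < β := by linarith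
  obtain ⟨γ, hγ⟩ : ∃ γ, γ = 1 - 2 * β := ⟨_, rfl⟩
  have hγ0 : 0 ≤ γ := by linarith
  have hm0 : (0:ℝ) < m := by linarith
  have hform : 0 < 2 * (m + 2) * (m - 1) * β ^ 2 - 2 * m * (m - 3) * (β * γ)
      + m ^ 2 * (m - 2) * γ ^ 2 := by
    have e1 : 2 * m ^ 2 * β ^ 2 ≤ 2 * (m + 2) * (m - 1) * β ^ 2 :=
      mul_le_mul_of_nonneg_right (by nlinarith) (sq_nonneg β)
    have e2 : 2 * m * (m - 3) * (β * γ) ≤ 2 * m ^ 2 * (β * γ) :=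
      mul_le_mul_of_nonneg_right (by nlinarith) (by positivity)
    have e3 : 2 * m ^ 2 * γ ^ 2 ≤ m ^ 2 * (m - 2) * γ ^ 2 :=
      mul_le_mul_of_nonneg_right (by nlinarith [sq_nonneg m]) (sq_nonneg γ)
    have e4 : 0 < m ^ 2 * (2 * β ^ 2 - 2 * (β * γ) + 2 * γ ^ 2) := by
      refine mul_pos (by positivity) ?_
      nlinarith [sq_nonneg (β - γ), sq_pos_of_pos hβ]
    nlinarith
  have key : ((1 - β) * (m + 3 - 2) + 2 * (1 - (1 - β)) * (m + 3 - 2) / (m + 3 - 3)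
        - (1 - β) * (m + 3 - 1)) *
      ((1 - β) * (m + 3 - 2) + 2 * (1 - (1 - β)) * (m + 3 - 2) / (m + 3 - 3) - (2 + (1 - β)))
      = (1 - (1 - β)) ^ 2 * (m + 3 - 1) - (2 * (m + 2) * (m - 1) * β ^ 2
        - 2 * m * (m - 3) * (β * γ) + m ^ 2 * (m - 2) * γ ^ 2) / m ^ 2 := by
    subst hγ
    have : m + 3 - 3 = m := by ring
    rw [this]
    field_simp
    ring
  rw [key]
  have : 0 < (2 * (m + 2) * (m - 1) * β ^ 2
        - 2 * m * (m - 3) * (β * γ) + m ^ 2 * (m - 2) * γ ^ 2) / m ^ 2 := by positivity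
  linarith

theorem lt_alphaIndex_wheelGraph {n : ℕ} (hn : 7 ≤ n) {α : ℝ} (h0 : 1 / 2 ≤ α) (h1 : α < 1) :
    α * (n - 2) + 2 * (1 - α) * (n - 2) / (n - 3) < (wheelGraph n).alphaIndex α := by
  have hn' : (7 : ℝ) ≤ n := by exact_mod_cast hn
  have hneg := wheel_quadratic_neg hn' h0 h1
  set r₀ : ℝ := α * (n - 2) + 2 * (1 - α) * (n - 2) / (n - 3)
  set D : ℝ := (α * (n - 1) - (2 + α)) ^ 2 + 4 * ((1 - α) ^ 2 * (n - 1)) with hD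
  have hD0 : 0 ≤ D := by
    have : 0 ≤ (1 - α) ^ 2 * ((n:ℝ) - 1) := mul_nonneg (sq_nonneg _) (by linarith)
    positivity
  have hsq := Real.sq_sqrt hD0
  have hs0 := Real.sqrt_nonneg D
  -- the larger root of the characteristic equation of the two-class quotient of the wheel
  set r : ℝ := (α * (n - 1) + (2 + α) + √D) / 2 with hr
  have hroot : (r - α * (n - 1)) * (r - (2 + α)) = (1 - α) ^ 2 * (n - 1) := by
    rw [hr]; nlinarith
  have hlt : r₀ < r := by
    by_contra! hle
    have h2 : α * (n - 1) + (2 + α) ≤ 2 * r := by rw [hr]; linarith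
    nlinarith
  have hα : (1 - α) ≠ 0 := by linarith
  refine hlt.trans_le (le_alphaIndex_wheelGraph (c := (r - (2 + α)) / (1 - α)) (by omega) ?_ ?_)
  · field_simp
    linarith
  · field_simp
    ring

/-- A minimally `3`-connected graph of order at least seven without a dominating vertex has a
smaller `α`-index than the wheel. -/
theorem IsMinimallyKConnected.alphaIndex_lt {V : Type*} [Fintype V] {G : SimpleGraph V}
    (h : G.IsMinimallyKConnected 3) (hn : 7 ≤ Fintype.card V)
    (hdom : ∀ v, ∃ y, y ≠ v ∧ ¬ G.Adj v y) {α : ℝ} (h0 : 1 / 2 ≤ α) (h1 : α < 1) :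
    G.alphaIndex α < (wheelGraph (Fintype.card V)).alphaIndex α := by
  classical
  have hne : Nonempty V := Fintype.card_pos_iff.1 (by omega)
  have hr := lt_alphaIndex_wheelGraph hn h0 h1
  have hpos : ∀ v, 0 < (G.degree v : ℝ) := fun v => by
    exact_mod_cast (Nat.zero_lt_succ 2).trans_le (h.1.three_le_degree v)
  refine G.alphaIndex_lt_of_mulVec_lt (by linarith) h1.le (fun v => (G.degree v : ℝ)) hpos
    fun v => ?_
  refine lt_of_le_of_lt ?_ (mul_lt_mul_of_pos_right hr (hpos v))
  rw [alphaMatrix_mulVec_apply]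
  have hD := h.degree_add_three_le hn hdom v
  have hsum := h.sum_degree_neighborFinset_le hn hdom v
  have hn' : (7 : ℝ) ≤ Fintype.card V := by exact_mod_cast hn
  have hD' : (G.degree v : ℝ) + 3 ≤ Fintype.card V := by exact_mod_cast hD
  have hd := hpos v
  have hα : 0 ≤ 1 - α := by linarith
  have hsplit : 2 * (1 - α) * ((Fintype.card V : ℝ) - 2) / (Fintype.card V - 3)
      = 2 * (1 - α) + (1 - α) * (2 / (Fintype.card V - 3)) := by
    have : (Fintype.card V : ℝ) - 3 ≠ 0 := by linarith
    field_simp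
    ring
  rw [hsplit]
  rcases hsum with hsum | ⟨hcard, hsum⟩
  · have hsum' : ∑ x ∈ G.neighborFinset v, (G.degree x : ℝ)
        ≤ G.degree v * (Fintype.card V - G.degree v) := by
      rw [← Nat.cast_sub (by omega)]
      exact_mod_cast hsum
    have e1 := mul_le_mul_of_nonneg_left hsum' hα
    have e2 : 0 ≤ (1 - α) * (2 / ((Fintype.card V : ℝ) - 3)) :=
      mul_nonneg hα (div_nonneg (by norm_num) (by linarith))
    have e3 : 0 ≤ (2 * α - 1) * ((Fintype.card V : ℝ) - 2 - G.degree v) :=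
      mul_nonneg (by linarith) (by linarith)
    have e4 := mul_nonneg e2 hd.le
    have e5 := mul_nonneg e3 hd.le
    nlinarith
  · have hsum' : ∑ x ∈ G.neighborFinset v, (G.degree x : ℝ) ≤ 3 * G.degree v + 2 := by
      exact_mod_cast hsum
    have hcard' : (Fintype.card V : ℝ) = G.degree v + 3 := by exact_mod_cast hcard.symm
    rw [hcard']
    have e1 := mul_le_mul_of_nonneg_left hsum' hα
    have e2 : (1 - α) * (2 / ((G.degree v : ℝ) + 3 - 3)) * G.degree v = (1 - α) * 2 := by
      rw [add_sub_cancel_right]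
      field_simp
    have e3 := mul_nonneg (by linarith : 0 ≤ 2 * α - 1) hd.le
    nlinarith

end SimpleGraph

theorem theorem1p2 {V : Type*} [Fintype V] (G : SimpleGraph V) (n : ℕ)
    (hn : 7 ≤ n) (hcard : Fintype.card V = n) (hG : G.IsMinimallyKConnected 3)
    (α : ℝ) (hα : α ∈ Set.Ico (1 / 2 : ℝ) 1) :
    G.alphaIndex α ≤ (SimpleGraph.wheelGraph n).alphaIndex α ∧
      (G.alphaIndex α = (SimpleGraph.wheelGraph n).alphaIndex α ↔
        Nonempty (G ≃g SimpleGraph.wheelGraph n)) := by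
  subst hcard
  have hV : Nonempty V := Fintype.card_pos_iff.1 (by omega)
  have hW : Nonempty (Fin 1 ⊕ Fin (Fintype.card V - 1)) := ⟨Sum.inl 0⟩
  by_cases hdom : ∀ v, ∃ y, y ≠ v ∧ ¬ G.Adj v y
  · have hlt := hG.alphaIndex_lt hn hdom hα.1 hα.2
    exact ⟨hlt.le, fun h => absurd h hlt.ne,
      fun ⟨e⟩ => absurd (SimpleGraph.alphaIndex_eq_of_iso e α) hlt.ne⟩
  · push Not at hdom
    obtain ⟨v, hv⟩ := hdom
    obtain ⟨e⟩ := hG.nonempty_iso_wheelGraph hv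
    have heq := SimpleGraph.alphaIndex_eq_of_iso e α
    exact ⟨heq.le, fun _ => ⟨e⟩, fun _ => heq⟩
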